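/- Let $\mathcal G=(\mathcal V,\mathcal E)$ be a finite digraph with weighted adjacency matrix $G=[g_{ik}]\in\mathbb R^{\mathcal V\times\mathcal V}$, where $g_{ik}=0$ whenever $(i,k)\notin\mathcal E$. Assume that $G$ is entrywise non-negative and that the network $\mathbf x[k+1]=G\mathbf x[k]+\mathbf e_q w[k]$, with a scalar input $w$ entering at the single node $q$, is stable (the spectral radius of $G$ is less than one). Paths are taken in the direction in which states propagate: the edge $(i,k)$, with weight $g_{ik}$, leads from $k$ to $i$. Let $\{j\}$ be a node cutset with partitioned set $\mathcal P$: for some $d\in\mathbb N$ there are non-empty sets $\mathcal S,\mathcal P$ such that $\mathcal V=\mathcal S\sqcup\{j\}\sqcup\mathcal P$ (disjoint union), $q\in\mathcal S$, every path from $q$ to $j$ has at least $d$ edges, and every path from $\mathcal S$ to $\mathcal P$ contains $j$. Let $\widetilde G=[\,G_{pp}\;\;G_{pc}\,]$ be the submatrix of $G$ with rows indexed by $\mathcal P$ and columns indexed by $\mathcal P$ (block $G_{pp}$) and $\{j\}$ (block $G_{pc}$), and let $\|\widetilde G\|_\infty$ be its largest absolute row sum. Let $D>0$, $\sigma_v^2>0$,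 $\sigma_1^2>\sigma_2^2\ge 0$, $\sigma_c^2\ge 0$, $\mu_1,\mu_2\in\mathbb R$ and $N\in\mathbb N$. For a node $l$ (a single sensor at $l$, with measurement noise variance $\sigma_v^2$) put $T_l(z)=\mathbf e_l^{\mathsf T}(zI-G)^{-1}\mathbf e_q$, $L_l=T_l(1)D^{1/2}$, $\|T_lD^{1/2}\|_\infty=\operatorname{ess\,sup}_{|z|=1}|T_l(z)D^{1/2}|$, and define $\eta_s(l)\ge 0$ and $R_s(l)$ by $$\eta_s(l)^2=\frac{N(\mu_2-\mu_1)^2L_l^2}{\sigma_c^2L_l^2+\sigma_v^2},\qquad R_s(l)=\frac{\sigma_1^2\|T_lD^{1/2}\|_\infty^2+\sigma_v^2}{\sigma_2^2\|T_lD^{1/2}\|_\infty^2+\sigma_v^2}.$$ These are the signal-to-noise ratios of the mean shift model $w[k]\sim\mathcal N(\mu_i,\sigma_c^2D)$ and of the covariance shift model $w[k]\sim\mathcal N(\mu_c,\sigma_i^2D)$ (hypotheses $H_i$, $i=1,2$). The corresponding (large horizon) mean and covariance shift error probabilities are defined by $$\mathbb P_{e_m}(l)=\tfrac12\,Q_{\mathcal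 N}\!\left(\tfrac12\eta_s(l)\right),\qquad \mathbb P_{e_v}(l)=\tfrac12\left[1-Q_{\chi^2}(1,\tau_l)\right]+\tfrac12\,Q_{\chi^2}\!\left(1,\tau_lR_s(l)\right),\qquad \tau_l=\frac{\ln R_s(l)}{R_s(l)-1},$$ with $\mathbb P_{e_v}(l)=\tfrac12$ if $R_s(l)=1$, where $Q_{\mathcal N}(t)=\Pr[Z\ge t]$ for $Z\sim\mathcal N(0,1)$ and $Q_{\chi^2}(1,t)=\Pr[Y\ge t]$ for $Y\sim\chi^2(1)$. Then: 1. If $\|\widetilde G\|_\infty\le 1$, then for every $j_1\in\mathcal P$, $\mathbb P_{e_m}(j)\le\mathbb P_{e_m}(j_1)$ and $\mathbb P_{e_v}(j)\le\mathbb P_{e_v}(j_1)$. 2. If every row sum of $\widetilde G$ is greater than one, then for every $j_1\in\mathcal P$, $\mathbb P_{e_m}(j_1)\le\mathbb P_{e_m}(j)$ and $\mathbb P_{e_v}(j_1)\le\mathbb P_{e_v}(j)$. -/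

import Mathlib

noncomputable section

namespace NetDetect

open MeasureTheory ProbabilityTheory
open scoped Matrix

section Graph

variable {V : Type*}

/-- `w` lists the consecutive nodes of a path from `a` to `b`. The weight `g_{vu}` of the edge
`(v, u)` multiplies `x_u[k]` in the update of `x_v[k+1]`, so a path goes along the edge `(v, u)`
from `u` to `v`, i.e. in the direction in which the states propagate. -/
def IsPath (E : Digraph V) (a b : V) (w : List V) : Prop :=
  w.IsChain (fun u v => E.Adj v u) ∧ w.head? = some a ∧ w.getLast? = some b

/-- `C` is a node cutset for the input nodes `K`, at distance at least `d` from them, with source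
set `S` and partitioned set `P`. A path with node list `w` has `w.length - 1` edges, and a distance
between sets that no path joins is infinite. -/
structure IsNodeCutset [DecidableEq V] [Fintype V] (E : Digraph V) (d : ℕ)
    (K S C P : Finset V) : Prop where
  source_nonempty : S.Nonempty
  part_nonempty : P.Nonempty
  cover : S ∪ C ∪ P = Finset.univ
  disj_source_cut : Disjoint S C
  disj_source_part : Disjoint S P
  disj_cut_part : Disjoint C P
  input_subset : K ⊆ S
  le_dist : ∀ k ∈ K, ∀ c ∈ C, ∀ w : List V, IsPath E k c w → d ≤ w.length - 1
  separates : ∀ s ∈ S, ∀ p ∈ P, ∀ w : List V, IsPath E s p w → ∃ c ∈ C, c ∈ w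

/-- The block matrix `[G_pp  G_pc]`. -/
def tildeG (G : Matrix V V ℝ) (P C : Finset V) : Matrix P (P ⊕ C) ℝ :=
  Matrix.fromCols (G.submatrix Subtype.val Subtype.val) (G.submatrix Subtype.val Subtype.val)

end Graph

/-- The induced `∞`-norm of a matrix: the largest absolute row sum. -/
def inftyNorm {m n : Type*} [Fintype m] [Fintype n] (A : Matrix m n ℝ) : ℝ :=
  letI : SeminormedAddCommGroup (Matrix m n ℝ) := Matrix.linftyOpSeminormedAddCommGroup
  ‖A‖

section Transfer

variable {V : Type*} [Fintype V] [DecidableEq V]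

/-- Stability of `x[k+1] = G x[k]`: the spectral radius is less than one. -/
def IsStable (G : Matrix V V ℝ) : Prop :=
  spectralRadius ℂ (G.map Complex.ofReal) < 1

/-- `T(z) = e_lᵀ (z I - A)⁻¹ e_q`: transfer function from the input node `q` to the node `l`. -/
def transfer {𝕜 : Type*} [Field 𝕜] (A : Matrix V V 𝕜) (q l : V) (z : 𝕜) : 𝕜 :=
  Pi.single l 1 ⬝ᵥ ((z • (1 : Matrix V V 𝕜) - A)⁻¹ *ᵥ Pi.single q 1)

/-- Essential supremum of `|F|` over the unit circle with arc length. -/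
def circleNorm (F : ℂ → ℂ) : ℝ :=
  (eLpNorm (fun θ : ℝ => F (circleMap 0 1 θ)) ⊤
    (volume.restrict (Set.Ioc 0 (2 * Real.pi)))).toReal

/-- Tail `Pr[Z ≥ t]` of `Z ∼ N(0, 1)`. -/
def QGauss (t : ℝ) : ℝ := (gaussianReal 0 1).real (Set.Ici t)

/-- The central chi-squared law with `p` degrees of freedom: the law of the sum of the squares of
`p` independent standard normal variables. -/
def chiSq (p : ℕ) : Measure ℝ :=
  (Measure.pi fun _ : Fin p => gaussianReal 0 1).map fun x => ∑ i, x i ^ 2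

/-- Tail `Pr[Y ≥ t]` of `Y ∼ χ²(p)`. -/
def QChiSq (p : ℕ) (t : ℝ) : ℝ := (chiSq p).real (Set.Ici t)

/-- The SNR `η_s` of the mean shift model `w[k] ∼ N(μ_i, σ_c² D)`, `i = 1, 2`, with sensor at `l`:
`η_s² = N μ_Δ² (σ_c² L² + σ_v²)⁻¹ L²` with `L = T(1) D^{1/2}` and `μ_Δ = μ₂ - μ₁`. -/
def etaS (G : Matrix V V ℝ) (q : V) (N : ℕ) (μ₁ μ₂ σc σv D : ℝ) (l : V) : ℝ :=
  let L := transfer G q l 1 * √D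
  √(N * (μ₂ - μ₁) ^ 2 * ((σc ^ 2 * L ^ 2 + σv ^ 2)⁻¹ * L ^ 2))

/-- The SNR `R_s` of the covariance shift model `w[k] ∼ N(μ_c, σ_i² D)`, `i = 1, 2`, with sensor
at `l`. -/
def RS (G : Matrix V V ℝ) (q : V) (σ₁ σ₂ σv D : ℝ) (l : V) : ℝ :=
  let t := circleNorm fun z => transfer (G.map Complex.ofReal) q l z * (√D : ℝ)
  (σ₁ ^ 2 * t ^ 2 + σv ^ 2) / (σ₂ ^ 2 * t ^ 2 + σv ^ 2)

/-- Error probability of the mean shift model with SNR `η`. -/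
def errMean (η : ℝ) : ℝ := 0.5 * QGauss (0.5 * η)

/-- Error probability of the covariance shift model with SNR `R`, where `τ = ln R / (R - 1)`.
At `R = 1` the value is `1/2`, whatever `τ` is. -/
def errCov (R : ℝ) : ℝ :=
  let τ := Real.log R / (R - 1)
  0.5 * (1 - QChiSq 1 τ) + 0.5 * QChiSq 1 (τ * R)

/-- `P_{e_m}(l)` for the single sensor `l`. -/
def Pem (G : Matrix V V ℝ) (q : V) (N : ℕ) (μ₁ μ₂ σc σv D : ℝ) (l : V) : ℝ :=
  errMean (etaS G q N μ₁ μ₂ σc σv D l)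

/-- `P_{e_v}(l)` for the single sensor `l`. -/
def Pev (G : Matrix V V ℝ) (q : V) (σ₁ σ₂ σv D : ℝ) (l : V) : ℝ :=
  errCov (RS G q σ₁ σ₂ σv D l)

end Transfer

end NetDetect

end

/-! Both error probabilities are antitone in the one number `transfer G q l 1`, the DC gain
`T_l(1)`. For the covariance shift this uses `norm_transfer_le`: since `G ≥ 0`, `|T_l(z)|` on the
unit circle peaks at `z = 1`, so the circle norm is also a DC gain (`circleNorm_transfer`).

It remains to compare `T_p(1)`, `p ∈ P`, with `T_j(1)`. The cutset forbids edges from `S` to `P`, so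
`T_p(1) = ∑_{k ∈ P} G_pk T_k(1) + G_pj T_j(1)`. With row sums at most one, `T_p(1) - T_j(1)` is
subharmonic on `P`; with row sums at least one, its negative is. A maximum principle finishes: if `u
≤ G u` with `G ≥ 0` stable, then `u ≤ Gⁿ u → 0`. -/

namespace NetDetect

open MeasureTheory ProbabilityTheory Filter Topology
open scoped Matrix

/-! ### Stability and the maximum principle -/

section Stability

variable {V : Type*} [Fintype V] [DecidableEq V]

/-- Gelfand's formula gives `‖Aⁿ‖ ≤ rⁿ` eventually, for some `r < 1`; the row-sum norm dominates
every entry. -/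
theorem IsStable.tendsto_pow {G : Matrix V V ℝ} (hs : IsStable G) (i k : V) :
    Tendsto (fun n : ℕ => (G ^ n) i k) atTop (𝓝 0) := by
  let : NormedRing (Matrix V V ℂ) := Matrix.linftyOpNormedRing
  let : NormedAlgebra ℂ (Matrix V V ℂ) := Matrix.linftyOpNormedAlgebra
  have : CompleteSpace (Matrix V V ℂ) := FiniteDimensional.complete ℂ _
  set A : Matrix V V ℂ := G.map Complex.ofReal with hA
  obtain ⟨r, hr, hr1⟩ := ENNReal.lt_iff_exists_nnreal_btwn.1 (show spectralRadius ℂ A < 1 from hs)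
  have hr1' : (r : ℝ) < 1 := by exact_mod_cast hr1
  have hev := (spectrum.pow_nnnorm_pow_one_div_tendsto_nhds_spectralRadius A).eventually_lt_const hr
  have hle : ∀ᶠ n : ℕ in atTop, |(G ^ n) i k| ≤ (r : ℝ) ^ n := by
    filter_upwards [hev, eventually_gt_atTop 0] with n hn hn0
    have h1 : (‖A ^ n‖₊ : ENNReal) < (r : ENNReal) ^ n := by
      have hn0' : (0 : ℝ) < n := by exact_mod_cast hn0
      have h2 := ENNReal.rpow_lt_rpow hn hn0'
      rwa [← ENNReal.rpow_mul, one_div, inv_mul_cancel₀ hn0'.ne', ENNReal.rpow_one,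
        ENNReal.rpow_natCast] at h2
    have h3 : ‖A ^ n‖₊ ≤ r ^ n := by exact_mod_cast h1.le
    have h4 : ‖(A ^ n) i k‖₊ ≤ ‖A ^ n‖₊ := by
      rw [Matrix.linfty_opNNNorm_def]
      exact (Finset.single_le_sum (f := fun j => ‖(A ^ n) i j‖₊) (fun _ _ => zero_le)
        (Finset.mem_univ k)).trans
        (Finset.le_sup (f := fun i => ∑ j, ‖(A ^ n) i j‖₊) (Finset.mem_univ i))
    have h5 : (A ^ n) i k = (((G ^ n) i k : ℝ) : ℂ) := by
      have : A ^ n = (G ^ n).map Complex.ofReal :=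
        (map_pow (Complex.ofRealHom.mapMatrix (m := V)) G n).symm
      rw [this]; rfl
    have h6 : ‖(A ^ n) i k‖ ≤ (r : ℝ) ^ n := by exact_mod_cast h4.trans h3
    rwa [h5, Complex.norm_real] at h6
  exact squeeze_zero_norm' hle (tendsto_pow_atTop_nhds_zero_of_lt_one r.2 hr1')

/-- A subharmonic vector of a stable non-negative matrix is non-positive. -/
theorem IsStable.nonpos_of_le_mulVec {G : Matrix V V ℝ} (hs : IsStable G) (hG : ∀ i k, 0 ≤ G i k)
    {u : V → ℝ} (hu : ∀ i, u i ≤ (G *ᵥ u) i) (i : V) : u i ≤ 0 := by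
  have hpow : ∀ n : ℕ, ∀ i, u i ≤ (G ^ n *ᵥ u) i := by
    intro n
    induction n with
    | zero => simp
    | succ n ih =>
      intro i
      rw [pow_succ', ← Matrix.mulVec_mulVec]
      exact (hu i).trans (Finset.sum_le_sum fun k _ => mul_le_mul_of_nonneg_left (ih k) (hG i k))
  have hlim : Tendsto (fun n : ℕ => (G ^ n *ᵥ u) i) atTop (𝓝 0) := by
    have := tendsto_finsetSum Finset.univ fun k _ => (hs.tendsto_pow i k).mul_const (u k)
    simpa [Matrix.mulVec, dotProduct] using this
  exact ge_of_tendsto' hlim fun n => hpow n i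

theorem IsStable.isUnit_sub {G : Matrix V V ℝ} (hs : IsStable G) {z : ℂ} (hz : ‖z‖ = 1) :
    IsUnit (z • (1 : Matrix V V ℂ) - G.map Complex.ofReal) := by
  have h : z ∈ resolventSet ℂ (G.map Complex.ofReal) := by
    refine spectrum.mem_resolventSet_of_spectralRadius_lt (lt_of_lt_of_eq hs ?_)
    have : ‖z‖₊ = 1 := by ext; simpa using hz
    simp [this]
  simpa [spectrum.mem_resolventSet_iff, Algebra.algebraMap_eq_smul_one] using h

theorem map_one_sub (G : Matrix V V ℝ) :
    (1 : ℂ) • (1 : Matrix V V ℂ) - G.map Complex.ofReal =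
      Complex.ofRealHom.mapMatrix ((1 : ℝ) • (1 : Matrix V V ℝ) - G) := by
  rw [map_sub, one_smul, one_smul, map_one]; rfl

theorem IsStable.isUnit_one_sub {G : Matrix V V ℝ} (hs : IsStable G) :
    IsUnit ((1 : ℝ) • (1 : Matrix V V ℝ) - G) := by
  have h := hs.isUnit_sub (z := 1) (by simp)
  rw [map_one_sub, Matrix.isUnit_iff_isUnit_det, ← RingHom.map_det] at h
  rw [Matrix.isUnit_iff_isUnit_det]
  rw [isUnit_iff_ne_zero] at h ⊢
  exact fun h0 => h (by rw [h0, map_zero])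

end Stability

/-! ### Transfer functions on the unit circle -/

section Transfer

variable {V : Type*} [Fintype V] [DecidableEq V]

theorem transfer_eq_inv_apply {𝕜 : Type*} [Field 𝕜] (A : Matrix V V 𝕜) (q l : V) (z : 𝕜) :
    transfer A q l z = (z • (1 : Matrix V V 𝕜) - A)⁻¹ l q := by
  simp [transfer]

/-- Column `q` of `(zI - A)(zI - A)⁻¹ = I`: a fixed-point equation to which the maximum principle
applies. -/
theorem smul_transfer {𝕜 : Type*} [Field 𝕜] {A : Matrix V V 𝕜} {z : 𝕜}
    (h : IsUnit (z • (1 : Matrix V V 𝕜) - A)) (q l : V) :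
    z * transfer A q l z = ∑ k, A l k * transfer A q k z + Pi.single (M := fun _ => 𝕜) q 1 l := by
  have h1 := congrFun₂ (Matrix.mul_nonsing_inv _ ((Matrix.isUnit_iff_isUnit_det _).1 h)) l q
  rw [Matrix.sub_mul, Matrix.sub_apply, Matrix.smul_mul, Matrix.one_mul, Matrix.smul_apply,
    Matrix.mul_apply, Matrix.one_apply] at h1
  simp only [transfer_eq_inv_apply, Pi.single_apply, smul_eq_mul] at h1 ⊢
  rw [← h1]; ring

theorem transfer_nonneg {G : Matrix V V ℝ} (hs : IsStable G) (hG : ∀ i k, 0 ≤ G i k) (q l : V) :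
    0 ≤ transfer G q l 1 := by
  have := hs.nonpos_of_le_mulVec hG (u := fun l => -transfer G q l 1) (fun i => by
    have h := smul_transfer hs.isUnit_one_sub q i
    have h0 : 0 ≤ Pi.single (M := fun _ => ℝ) q 1 i := by
      rw [Pi.single_apply]; split_ifs <;> norm_num
    simp only [Matrix.mulVec, dotProduct, mul_neg, Finset.sum_neg_distrib]
    linarith) l
  linarith

/-- By the triangle inequality `|T(z)|` satisfies, as an inequality, the equation of `T(1)` with the
same source term, so the difference is subharmonic. -/
theorem norm_transfer_le {G : Matrix V V ℝ} (hs : IsStable G) (hG : ∀ i k, 0 ≤ G i k) (q l : V)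
    {z : ℂ} (hz : ‖z‖ = 1) :
    ‖transfer (G.map Complex.ofReal) q l z‖ ≤ transfer G q l 1 := by
  have := hs.nonpos_of_le_mulVec hG
    (u := fun l => ‖transfer (G.map Complex.ofReal) q l z‖ - transfer G q l 1) (fun i => by
    have h := smul_transfer hs.isUnit_one_sub q i
    have hC := congrArg norm (smul_transfer (hs.isUnit_sub hz) q i)
    rw [norm_mul, hz, one_mul] at hC
    have h1 : ‖∑ k, G.map Complex.ofReal i k * transfer (G.map Complex.ofReal) q k z‖ ≤
        ∑ k, G i k * ‖transfer (G.map Complex.ofReal) q k z‖ := by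
      refine (norm_sum_le _ _).trans_eq (Finset.sum_congr rfl fun k _ => ?_)
      rw [norm_mul, Matrix.map_apply, Complex.norm_real, Real.norm_of_nonneg (hG i k)]
    have h2 : ‖Pi.single (M := fun _ => ℂ) q 1 i‖ = Pi.single (M := fun _ => ℝ) q 1 i := by
      rw [Pi.single_apply, Pi.single_apply]; split_ifs <;> simp
    have h3 := hC.le.trans ((norm_add_le _ _).trans (add_le_add h1 h2.le))
    simp only [Matrix.mulVec, dotProduct, mul_sub, Finset.sum_sub_distrib]
    linarith) l
  linarith

theorem transfer_map_one {G : Matrix V V ℝ} (q l : V) :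
    transfer (G.map Complex.ofReal) q l 1 = (transfer G q l 1 : ℝ) := by
  rw [transfer_eq_inv_apply, transfer_eq_inv_apply, map_one_sub, Matrix.inv_def, Matrix.inv_def,
    ← RingHom.map_det, ← RingHom.map_adjugate, Ring.inverse_eq_inv', Ring.inverse_eq_inv']
  simp

theorem continuous_transfer_circleMap {G : Matrix V V ℝ} (hs : IsStable G) (q l : V) :
    Continuous fun θ : ℝ => transfer (G.map Complex.ofReal) q l (circleMap 0 1 θ) := by
  simp only [transfer_eq_inv_apply]
  refine Continuous.matrix_elem (continuous_iff_continuousAt.2 fun θ => ?_) l q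
  have hu := hs.isUnit_sub (z := circleMap 0 1 θ) (by simp)
  refine ContinuousAt.comp (g := Inv.inv) (continuousAt_matrix_inv _ ?_) (Continuous.continuousAt ?_)
  · rw [Ring.inverse_eq_inv']
    exact continuousAt_inv₀ (((Matrix.isUnit_iff_isUnit_det _).1 hu).ne_zero)
  · fun_prop

theorem circleNorm_eq_of_norm_le {F : ℂ → ℂ} (hc : Continuous fun θ : ℝ => F (circleMap 0 1 θ))
    (hF : ∀ z, ‖z‖ = 1 → ‖F z‖ ≤ ‖F 1‖) : circleNorm F = ‖F 1‖ := by
  have hle : eLpNorm (fun θ : ℝ => F (circleMap 0 1 θ)) ⊤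
      (volume.restrict (Set.Ioc 0 (2 * Real.pi))) ≤ ENNReal.ofReal ‖F 1‖ := by
    rw [eLpNorm_exponent_top]
    exact eLpNormEssSup_le_of_ae_bound (Eventually.of_forall fun θ => hF _ (by simp))
  refine le_antisymm (ENNReal.toReal_le_of_le_ofReal (norm_nonneg _) hle) ?_
  by_contra! hlt
  have hbound : ∀ᵐ θ ∂(volume.restrict (Set.Ioc 0 (2 * Real.pi))),
      ‖F (circleMap 0 1 θ)‖ ≤ circleNorm F := by
    have h := ae_le_eLpNormEssSup (f := fun θ : ℝ => F (circleMap 0 1 θ))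
      (μ := volume.restrict (Set.Ioc 0 (2 * Real.pi)))
    filter_upwards [h] with θ hθ
    rw [← eLpNorm_exponent_top] at hθ
    have := ENNReal.toReal_mono (ne_top_of_le_ne_top ENNReal.ofReal_ne_top hle) hθ
    rwa [toReal_enorm] at this
  -- The maximum sits at `θ = 0`, an endpoint outside `(0, 2π]`; by continuity the strict bound
  -- persists on a right neighbourhood of positive length.
  have hnear : ∀ᶠ θ : ℝ in 𝓝 0, circleNorm F < ‖F (circleMap 0 1 θ)‖ := by
    refine hc.norm.continuousAt.eventually_const_lt ?_
    simpa [circleMap] using hlt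
  obtain ⟨ε, hε, hball⟩ := Metric.eventually_nhds_iff.1 hnear
  have hpos : 0 < min ε (2 * Real.pi) := lt_min hε Real.two_pi_pos
  have hnull := (ae_restrict_iff' measurableSet_Ioc).1 hbound
  have h0 : volume (Set.Ioo 0 (min ε (2 * Real.pi))) = 0 := by
    refine measure_mono_null (fun θ hθ => ?_) (ae_iff.1 hnull)
    simp only [Set.mem_ofPred_eq, not_forall, not_le]
    refine ⟨⟨hθ.1, (hθ.2.trans_le (min_le_right _ _)).le⟩, hball ?_⟩
    rw [Real.dist_eq, sub_zero, abs_of_pos hθ.1]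
    exact hθ.2.trans_le (min_le_left _ _)
  rw [Real.volume_Ioo, sub_zero, ENNReal.ofReal_eq_zero] at h0
  exact absurd h0 (not_le.2 hpos)

theorem circleNorm_transfer {G : Matrix V V ℝ} (hs : IsStable G) (hG : ∀ i k, 0 ≤ G i k)
    (q l : V) (D : ℝ) :
    circleNorm (fun z => transfer (G.map Complex.ofReal) q l z * (√D : ℝ)) =
      transfer G q l 1 * √D := by
  have h1 : ‖transfer (G.map Complex.ofReal) q l 1‖ = transfer G q l 1 := by
    rw [transfer_map_one, Complex.norm_real, Real.norm_of_nonneg (transfer_nonneg hs hG q l)]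
  have hD : ‖((√D : ℝ) : ℂ)‖ = √D := by
    rw [Complex.norm_real, Real.norm_of_nonneg (Real.sqrt_nonneg D)]
  rw [circleNorm_eq_of_norm_le ((continuous_transfer_circleMap hs q l).mul continuous_const),
    norm_mul, h1, hD]
  intro z hz
  rw [norm_mul, norm_mul, h1]
  exact mul_le_mul_of_nonneg_right (norm_transfer_le hs hG q l hz) (norm_nonneg _)

end Transfer

/-! ### Row sums of the block matrix -/

section RowSums

/-- A general `f` covers both the absolute and the signed row sums. -/
theorem tildeG_rowSum {V : Type*} {G : Matrix V V ℝ} {j : V} {P : Finset V} (f : ℝ → ℝ) (i : P) :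
    ∑ k, f (tildeG G P {j} i k) = ∑ k ∈ P, f (G i k) + f (G i j) := by
  rw [Fintype.sum_sum_type, ← Finset.sum_coe_sort P]
  simp [tildeG]

theorem rowSum_le_inftyNorm {m n : Type*} [Fintype m] [Fintype n] (A : Matrix m n ℝ) (i : m) :
    ∑ k, |A i k| ≤ inftyNorm A := by
  let : SeminormedAddCommGroup (Matrix m n ℝ) := Matrix.linftyOpSeminormedAddCommGroup
  have h : ∑ k, ‖A i k‖₊ ≤ ‖A‖₊ := by
    rw [Matrix.linfty_opNNNorm_def]
    exact Finset.le_sup (f := fun i => ∑ k, ‖A i k‖₊) (Finset.mem_univ i)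
  have h' : ((∑ k, ‖A i k‖₊ : NNReal) : ℝ) ≤ (‖A‖₊ : NNReal) := by exact_mod_cast h
  rw [NNReal.coe_sum] at h'
  exact h'

end RowSums

/-! ### Comparing gains across the cutset -/

section Cutset

variable {V : Type*} [Fintype V] [DecidableEq V] {E : Digraph V} {G : Matrix V V ℝ}
  {d : ℕ} {q j : V} {S P : Finset V}

theorem IsNodeCutset.weight_eq_zero {K C : Finset V} (hcut : IsNodeCutset E d K S C P)
    (hGE : ∀ i k, ¬ E.Adj i k → G i k = 0) {p s : V} (hp : p ∈ P) (hs : s ∈ S) : G p s = 0 := by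
  refine hGE p s fun hadj => ?_
  -- A single edge from `s` to `p` would be a path that misses the cutset.
  obtain ⟨c, hc, hcw⟩ := hcut.separates s hs p hp [s, p] ⟨by simpa using hadj, rfl, rfl⟩
  rcases List.mem_pair.1 hcw with rfl | rfl
  · exact Finset.disjoint_left.1 hcut.disj_source_cut hs hc
  · exact Finset.disjoint_left.1 hcut.disj_cut_part hc hp

theorem IsNodeCutset.sum_mul_eq (hcut : IsNodeCutset E d {q} S {j} P)
    (hGE : ∀ i k, ¬ E.Adj i k → G i k = 0) {p : V} (hp : p ∈ P) (x : V → ℝ) :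
    ∑ k, G p k * x k = ∑ k ∈ P, G p k * x k + G p j * x j := by
  rw [← hcut.cover, Finset.sum_union (Finset.disjoint_union_left.2
      ⟨hcut.disj_source_part, hcut.disj_cut_part⟩), Finset.sum_union hcut.disj_source_cut,
    Finset.sum_singleton,
    Finset.sum_eq_zero fun s hs => by rw [hcut.weight_eq_zero hGE hp hs, zero_mul]]
  ring

theorem IsNodeCutset.transfer_eq (hcut : IsNodeCutset E d {q} S {j} P)
    (hGE : ∀ i k, ¬ E.Adj i k → G i k = 0) (hs : IsStable G) {p : V} (hp : p ∈ P) :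
    transfer G q p 1 = ∑ k ∈ P, G p k * transfer G q k 1 + G p j * transfer G q j 1 := by
  have h := smul_transfer hs.isUnit_one_sub q p
  have hpq : p ≠ q := fun h => Finset.disjoint_left.1 hcut.disj_source_part
    (hcut.input_subset (Finset.mem_singleton_self q)) (h ▸ hp)
  rwa [Pi.single_eq_of_ne hpq, one_mul, add_zero, hcut.sum_mul_eq hGE hp] at h

/-- A vector that is subharmonic on `P` is non-positive on `P`. -/
theorem IsStable.nonpos_of_le_sum (hs : IsStable G) (hG : ∀ i k, 0 ≤ G i k) {y : V → ℝ}
    (hy : ∀ p ∈ P, y p ≤ ∑ k ∈ P, G p k * y k) {p : V} (hp : p ∈ P) : y p ≤ 0 := by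
  -- The positive part, extended by zero off `P`, is subharmonic on all of `V`, so stability of `G`
  -- itself suffices.
  have hu := hs.nonpos_of_le_mulVec hG (u := fun v => if v ∈ P then max (y v) 0 else 0)
    (fun i => by
      have h0 : 0 ≤ (G *ᵥ fun v => if v ∈ P then max (y v) 0 else 0) i :=
        Finset.sum_nonneg fun k _ => mul_nonneg (hG i k) (by
        beta_reduce; split_ifs <;> simp)
      split_ifs with hi
      · refine max_le ((hy i hi).trans ?_) h0
        simp only [Matrix.mulVec, dotProduct, mul_ite, mul_zero]
        rw [← Finset.sum_filter, Finset.filter_univ_mem]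
        exact Finset.sum_le_sum fun k _ => mul_le_mul_of_nonneg_left (le_max_left _ _) (hG i k)
      · exact h0) p
  rw [if_pos hp] at hu
  exact (le_max_left _ _).trans hu

theorem IsNodeCutset.transfer_le (hcut : IsNodeCutset E d {q} S {j} P)
    (hGE : ∀ i k, ¬ E.Adj i k → G i k = 0) (hs : IsStable G) (hG : ∀ i k, 0 ≤ G i k)
    (hrow : ∀ p ∈ P, ∑ k ∈ P, G p k + G p j ≤ 1) {p : V} (hp : p ∈ P) :
    transfer G q p 1 ≤ transfer G q j 1 := by
  have := hs.nonpos_of_le_sum hG (P := P) (y := fun v => transfer G q v 1 - transfer G q j 1)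
    (fun i hi => by
      have h1 := hcut.transfer_eq hGE hs hi
      have h2 := mul_le_mul_of_nonneg_right (hrow i hi) (transfer_nonneg hs hG q j)
      simp only [mul_sub, Finset.sum_sub_distrib, ← Finset.sum_mul]
      linarith) hp
  linarith

theorem IsNodeCutset.le_transfer (hcut : IsNodeCutset E d {q} S {j} P)
    (hGE : ∀ i k, ¬ E.Adj i k → G i k = 0) (hs : IsStable G) (hG : ∀ i k, 0 ≤ G i k)
    (hrow : ∀ p ∈ P, 1 ≤ ∑ k ∈ P, G p k + G p j) {p : V} (hp : p ∈ P) :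
    transfer G q j 1 ≤ transfer G q p 1 := by
  have := hs.nonpos_of_le_sum hG (P := P) (y := fun v => transfer G q j 1 - transfer G q v 1)
    (fun i hi => by
      have h1 := hcut.transfer_eq hGE hs hi
      have h2 := mul_le_mul_of_nonneg_right (hrow i hi) (transfer_nonneg hs hG q j)
      simp only [mul_sub, Finset.sum_sub_distrib, ← Finset.sum_mul]
      linarith) hp
  linarith

end Cutset

/-! ### Monotonicity of the error probabilities -/

section ErrorProbabilities

theorem errMean_antitone : Antitone errMean := by
  intro a b hab
  unfold errMean QGauss
  have : (gaussianReal 0 1).real (Set.Ici (0.5 * b)) ≤ (gaussianReal 0 1).real (Set.Ici (0.5 * a)) :=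
    measureReal_mono (Set.Ici_subset_Ici.2 (by linarith))
  linarith

instance (p : ℕ) : IsProbabilityMeasure (chiSq p) :=
  Measure.isProbabilityMeasure_map
    (Finset.measurable_sum _ fun i _ => (measurable_pi_apply i).pow_const 2).aemeasurable

theorem QChiSq_antitone (p : ℕ) : Antitone (QChiSq p) := fun _ _ hab =>
  measureReal_mono (Set.Ici_subset_Ici.2 hab)

/-- This is the slope of a secant of the concave `log` from the point `1`. -/
theorem log_div_sub_one_antitone {a b : ℝ} (ha : 1 < a) (hab : a ≤ b) :
    Real.log b / (b - 1) ≤ Real.log a / (a - 1) := by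
  have h := strictConcaveOn_log_Ioi.concaveOn.neg.secant_mono (a := 1) (x := a) (y := b)
    (Set.mem_Ioi.2 one_pos) (Set.mem_Ioi.2 (by linarith)) (Set.mem_Ioi.2 (by linarith))
    ha.ne' (by linarith) hab
  simpa [neg_div] using h

/-- Likewise a secant slope from `1`, now of the convex `x log x`. -/
theorem log_div_sub_one_mul_monotone {a b : ℝ} (ha : 1 < a) (hab : a ≤ b) :
    Real.log a / (a - 1) * a ≤ Real.log b / (b - 1) * b := by
  have h := Real.convexOn_mul_log.secant_mono (a := 1) (x := a) (y := b)
    (Set.mem_Ici.2 one_pos.le) (Set.mem_Ici.2 (by linarith)) (Set.mem_Ici.2 (by linarith))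
    ha.ne' (by linarith) hab
  simp only [Real.log_one, mul_zero, sub_zero] at h
  rwa [div_mul_eq_mul_div, div_mul_eq_mul_div, mul_comm (Real.log a), mul_comm (Real.log b)]

/-- As `R` grows, `τ` falls and `τ R` rises, so both error terms decrease. -/
theorem errCov_antitoneOn : AntitoneOn errCov (Set.Ici 1) := by
  intro a ha b _ hab
  rcases (Set.mem_Ici.1 ha).eq_or_lt with rfl | ha
  -- At `R = 1`, `log 1 = 0` makes `τ = 0`, the two tails cancel and the value is `1/2`; any `b ≥ 1`
  -- does no worse because `τ ≤ τ b`.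
  · have hτ : Real.log b / (b - 1) ≤ Real.log b / (b - 1) * b :=
      le_mul_of_one_le_right (div_nonneg (Real.log_nonneg hab) (by linarith)) hab
    have := QChiSq_antitone 1 hτ
    simp only [errCov, Real.log_one, zero_div, zero_mul]
    linarith
  · have h1 := QChiSq_antitone 1 (log_div_sub_one_antitone ha hab)
    have h2 := QChiSq_antitone 1 (log_div_sub_one_mul_monotone ha hab)
    simp only [errCov]
    linarith

theorem inv_mul_mono {a b x y : ℝ} (ha : 0 ≤ a) (hb : 0 < b) (hx : 0 ≤ x) (hxy : x ≤ y) :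
    (a * x + b)⁻¹ * x ≤ (a * y + b)⁻¹ * y := by
  have h1 : 0 < a * x + b := by positivity
  have h2 : 0 < a * y + b := by have := hx.trans hxy; positivity
  rw [inv_mul_eq_div, inv_mul_eq_div, div_le_div_iff₀ h1 h2]
  linarith [mul_le_mul_of_nonneg_left hxy hb.le]

theorem add_div_add_mono {a b c x y : ℝ} (hc : 0 ≤ c) (hca : c ≤ a) (hb : 0 < b) (hx : 0 ≤ x)
    (hxy : x ≤ y) : (a * x + b) / (c * x + b) ≤ (a * y + b) / (c * y + b) := by
  have h1 : 0 < c * x + b := by positivity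
  have h2 : 0 < c * y + b := by have := hx.trans hxy; positivity
  rw [div_le_div_iff₀ h1 h2]
  -- After cross-multiplying, the difference of the sides is `b (a - c) (y - x)`.
  linarith [mul_le_mul_of_nonneg_right (mul_le_mul_of_nonneg_left hxy hb.le) (sub_nonneg.2 hca)]

theorem one_le_add_div_add {a b c x : ℝ} (hc : 0 ≤ c) (hca : c ≤ a) (hb : 0 < b) (hx : 0 ≤ x) :
    1 ≤ (a * x + b) / (c * x + b) := by
  rw [one_le_div (by positivity)]
  linarith [mul_le_mul_of_nonneg_right hca hx]

variable {V : Type*} [Fintype V] [DecidableEq V] {G : Matrix V V ℝ} {q l m : V}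

theorem Pem_le_of_transfer_le (hs : IsStable G) (hG : ∀ i k, 0 ≤ G i k)
    (h : transfer G q l 1 ≤ transfer G q m 1) (N : ℕ) (μ₁ μ₂ σc : ℝ) {σv : ℝ} (D : ℝ)
    (hσv : 0 < σv ^ 2) : Pem G q N μ₁ μ₂ σc σv D m ≤ Pem G q N μ₁ μ₂ σc σv D l := by
  refine errMean_antitone (Real.sqrt_le_sqrt (mul_le_mul_of_nonneg_left
    (inv_mul_mono (sq_nonneg _) hσv (sq_nonneg _) ?_) (by positivity)))
  have h0 := transfer_nonneg hs hG q l
  gcongr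

theorem Pev_le_of_transfer_le (hs : IsStable G) (hG : ∀ i k, 0 ≤ G i k)
    (h : transfer G q l 1 ≤ transfer G q m 1) {σ₁ σ₂ σv : ℝ} (D : ℝ) (hσ : σ₂ ^ 2 < σ₁ ^ 2)
    (hσv : 0 < σv ^ 2) : Pev G q σ₁ σ₂ σv D m ≤ Pev G q σ₁ σ₂ σv D l := by
  have h0 := transfer_nonneg hs hG q l
  refine errCov_antitoneOn ?_ ?_ ?_
  · exact one_le_add_div_add (sq_nonneg _) hσ.le hσv (sq_nonneg _)
  · exact one_le_add_div_add (sq_nonneg _) hσ.le hσv (sq_nonneg _)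
  · refine add_div_add_mono (sq_nonneg _) hσ.le hσv (sq_nonneg _) ?_
    rw [circleNorm_transfer hs hG, circleNorm_transfer hs hG]
    gcongr

end ErrorProbabilities

end NetDetect


theorem mainTheorem8 {V : Type*} [Fintype V] [DecidableEq V]
    -- the network, its non-negative weighted adjacency matrix, and stability
    (E : Digraph V) (G : Matrix V V ℝ) (hGE : ∀ i k, ¬ E.Adj i k → G i k = 0)
    (hG : ∀ i k, 0 ≤ G i k) (hstable : NetDetect.IsStable G)
    -- input node, singleton node cutset, source set and partitioned set
    (q j : V) (d : ℕ) (S P : Finset V) (hcut : NetDetect.IsNodeCutset E d {q} S {j} P)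
    -- horizon, input statistics, and sensor noise
    (N : ℕ) (μ₁ μ₂ σc σ₁ σ₂ σv D : ℝ) (hD : 0 < D) (hσ : σ₂ ^ 2 < σ₁ ^ 2) (hσv : 0 < σv ^ 2) :
    (NetDetect.inftyNorm (NetDetect.tildeG G P {j}) ≤ 1 →
      ∀ j₁ ∈ P,
        NetDetect.Pem G q N μ₁ μ₂ σc σv D j ≤ NetDetect.Pem G q N μ₁ μ₂ σc σv D j₁ ∧
        NetDetect.Pev G q σ₁ σ₂ σv D j ≤ NetDetect.Pev G q σ₁ σ₂ σv D j₁) ∧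
    ((∀ i : P, 1 < ∑ k, NetDetect.tildeG G P {j} i k) →
      ∀ j₁ ∈ P,
        NetDetect.Pem G q N μ₁ μ₂ σc σv D j₁ ≤ NetDetect.Pem G q N μ₁ μ₂ σc σv D j ∧
        NetDetect.Pev G q σ₁ σ₂ σv D j₁ ≤ NetDetect.Pev G q σ₁ σ₂ σv D j) := by
  refine ⟨fun hnorm j₁ hj₁ => ?_, fun hrow j₁ hj₁ => ?_⟩
  · have h := hcut.transfer_le hGE hstable hG (fun p hp => by
      have h1 := (NetDetect.rowSum_le_inftyNorm _ ⟨p, hp⟩).trans hnorm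
      rw [NetDetect.tildeG_rowSum] at h1
      simpa only [abs_of_nonneg (hG _ _)] using h1) hj₁
    exact ⟨NetDetect.Pem_le_of_transfer_le hstable hG h N μ₁ μ₂ σc D hσv,
      NetDetect.Pev_le_of_transfer_le hstable hG h D hσ hσv⟩
  · have h := hcut.le_transfer hGE hstable hG (fun p hp => by
      have h1 := hrow ⟨p, hp⟩
      rw [NetDetect.tildeG_rowSum fun x => x] at h1
      exact h1.le) hj₁
    exact ⟨NetDetect.Pem_le_of_transfer_le hstable hG h N μ₁ μ₂ σc D hσv,
      NetDetect.Pev_le_of_transfer_le hstable hG h D hσ hσv⟩
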